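/- Let $|\psi\rangle_{ABC}\in\mathbb C^2\otimes\mathbb C^2\otimes\mathbb C^2$ be a unit vector (a three-qubit pure state), and for distinct $X,Y\in\{A,B,C\}$ let $\rho_{XY}$ be the reduced density operator of $|\psi\rangle\langle\psi|$ on the qubits $X,Y$, with marginals $\rho_X,\rho_Y$. Let $S(\rho)=-\mathrm{Tr}\,\rho\log_2\rho$, and define the one-way quantum discord (with measurement on $Y$) by $$\delta_{XY}^{\leftarrow}=S(\rho_X)+S(\rho_Y)-S(\rho_{XY})-\sup_{\{\Pi_x\}}\Big(S(\rho_X)-\sum_x p_x\,S(\rho_X^x)\Big),$$ where the supremum is over all finite positive-operator-valued measurements on $Y$ ($\Pi_x\ge 0$, $\sum_x\Pi_x=I$), $p_x=\mathrm{Tr}[(I\otimes\Pi_x)\rho_{XY}]$ and $\rho_X^x=\mathrm{Tr}_Y[(I\otimes\Pi_x)\rho_{XY}]/p_x$ (terms with $p_x=0$ being $0$). Then $$\delta_{AB}^{\leftarrow}+\delta_{BC}^{\leftarrow}+\delta_{CA}^{\leftarrow}+\delta_{BA}^{\leftarrow}+\delta_{AC}^{\leftarrow}+\delta_{CB}^{\leftarrow}\le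 2c_{\max},\qquad c_{\max}=3\,h\Big(\frac12+\frac{\sqrt5}{6}\Big),$$ where $h(x)=-x\log_2x-(1-x)\log_2(1-x)$. -/

import Mathlib

open scoped Kronecker ComplexOrder

noncomputable section

namespace Discord

/-- The von Neumann entropy in bits, `-∑ λ log₂ λ`, the sum running over the eigenvalues `λ` of `ρ`
(the roots of the characteristic polynomial, with multiplicity; they are real for a Hermitian
`ρ`), with `0 log₂ 0 = 0`. -/
def entropy {a : Type*} [Fintype a] [DecidableEq a] (ρ : Matrix a a ℂ) : ℝ :=
  (ρ.charpoly.roots.map fun z : ℂ => Real.negMulLog z.re).sum / Real.log 2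

/-- Partial trace over the first factor. -/
def traceLeft {a b : Type*} [Fintype a] (ρ : Matrix (a × b) (a × b) ℂ) : Matrix b b ℂ :=
  Matrix.of fun j j' => ∑ i, ρ (i, j) (i, j')

/-- Partial trace over the second factor. -/
def traceRight {a b : Type*} [Fintype b] (ρ : Matrix (a × b) (a × b) ℂ) : Matrix a a ℂ :=
  Matrix.of fun i i' => ∑ j, ρ (i, j) (i', j)

/-- The same bipartite operator with the order of the two subsystems exchanged. -/
def swap {a b : Type*} (ρ : Matrix (a × b) (a × b) ℂ) : Matrix (b × a) (b × a) ℂ :=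
  ρ.submatrix Prod.swap Prod.swap

/-- A positive-operator-valued measurement with outcomes `0, …, n - 1`. -/
structure IsPOVM {b : Type*} [Fintype b] [DecidableEq b] {n : ℕ}
    (P : Fin n → Matrix b b ℂ) : Prop where
  posSemidef : ∀ x, (P x).PosSemidef
  sum_eq_one : ∑ x, P x = 1

section Bipartite

variable {a b : Type*} [Fintype a] [DecidableEq a] [Fintype b] [DecidableEq b]

/-- The probability of the outcome with effect `E` on the second subsystem. -/
def outcomeProb (ρ : Matrix (a × b) (a × b) ℂ) (E : Matrix b b ℂ) : ℝ :=
  (((1 : Matrix a a ℂ) ⊗ₖ E) * ρ).trace.re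

/-- The state of the first subsystem conditioned on the outcome with effect `E` on the second one.
(Where the probability is zero this is the zero matrix, and it only occurs with weight zero.) -/
def condState (ρ : Matrix (a × b) (a × b) ℂ) (E : Matrix b b ℂ) : Matrix a a ℂ :=
  ((outcomeProb ρ E : ℝ) : ℂ)⁻¹ • traceRight (((1 : Matrix a a ℂ) ⊗ₖ E) * ρ)

/-- `S(ρ_A) - ∑ₓ pₓ S(ρ_Aˣ)` for a measurement `P` on the second subsystem. -/
def informationGain (ρ : Matrix (a × b) (a × b) ℂ) {n : ℕ} (P : Fin n → Matrix b b ℂ) : ℝ :=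
  entropy (traceRight ρ) - ∑ x, outcomeProb ρ (P x) * entropy (condState ρ (P x))

/-- The classical correlation `J^←`: the information gain optimized over all POVMs (with any finite
number of outcomes) on the second subsystem. -/
def classicalCorrelation (ρ : Matrix (a × b) (a × b) ℂ) : ℝ :=
  sSup {v : ℝ | ∃ (n : ℕ) (P : Fin n → Matrix b b ℂ), IsPOVM P ∧ v = informationGain ρ P}

/-- The quantum mutual information `S(ρ_A) + S(ρ_B) - S(ρ_AB)`. -/
def mutualInformation (ρ : Matrix (a × b) (a × b) ℂ) : ℝ :=
  entropy (traceRight ρ) + entropy (traceLeft ρ) - entropy ρ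

/-- The one-way quantum discord `δ^← = I - J^←`, the measurement acting on the second subsystem. -/
def discord (ρ : Matrix (a × b) (a × b) ℂ) : ℝ :=
  mutualInformation ρ - classicalCorrelation ρ

end Bipartite

/-- State vectors of three qubits `A`, `B`, `C`, in the computational basis. -/
abbrev ThreeQubit : Type := EuclideanSpace ℂ (Fin 2 × Fin 2 × Fin 2)

/-- The operator `|ψ⟩⟨ψ|`. -/
def pureDensity {d : Type*} (ψ : EuclideanSpace ℂ d) : Matrix d d ℂ :=
  Matrix.of fun i j => ψ i * star (ψ j)

/-- `ρ_AB = Tr_C |ψ⟩⟨ψ|`. -/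
def rhoAB (ψ : ThreeQubit) : Matrix (Fin 2 × Fin 2) (Fin 2 × Fin 2) ℂ :=
  Matrix.of fun p q => ∑ k, pureDensity ψ (p.1, p.2, k) (q.1, q.2, k)

/-- `ρ_AC = Tr_B |ψ⟩⟨ψ|`. -/
def rhoAC (ψ : ThreeQubit) : Matrix (Fin 2 × Fin 2) (Fin 2 × Fin 2) ℂ :=
  Matrix.of fun p q => ∑ j, pureDensity ψ (p.1, j, p.2) (q.1, j, q.2)

/-- `ρ_BC = Tr_A |ψ⟩⟨ψ|`. -/
def rhoBC (ψ : ThreeQubit) : Matrix (Fin 2 × Fin 2) (Fin 2 × Fin 2) ℂ :=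
  Matrix.of fun p q => ∑ i, pureDensity ψ (i, p.1, p.2) (i, q.1, q.2)

/-- The binary entropy in bits, `h(x) = -x log₂ x - (1 - x) log₂ (1 - x)`. -/
def h (x : ℝ) : ℝ :=
  -x * Real.logb 2 x - (1 - x) * Real.logb 2 (1 - x)

/-- `c_max = 3 h(1/2 + √5/6)`. -/
def cMax : ℝ := 3 * h (1 / 2 + Real.sqrt 5 / 6)

end Discord

end

/-! For a pure state on XYZ, S(XY) = S(Z), so the discord of XY measured on Y is S(Y) - S(Z) plus
the least average entropy of X after the measurement. By the Koashi–Winter relation that least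
average is the entanglement of formation of XZ, a function `eof` of its squared concurrence. Only
the upper bound on the discord is needed, so a single good measurement suffices
(`exists_optimal_basis`, `discord_pairOp_le`). Over the six ordered pairs the one-qubit entropies
cancel and each `eof` occurs twice.

It remains to bound the sum of the three `eof` values. The squared concurrences add up to at most
4/3, with equality for the W state (`gapSum_le`), and `eof` lies below its nonnegatively sloped
tangent at 4/9 (`eof_add_le`).

The squared concurrence of two qubits is computed from the slices along the third: the symmetric
matrix `tau` polarizes twice their determinant, and the concurrence is the difference of its
singular values. This is invariant under local unitaries, which permits canonical forms. -/

noncomputable section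

namespace Discord

open Matrix

/-! ### The entropy of a qubit as a function of four times the determinant -/

/-- The binary entropy in bits of the distribution with bias `√(1 - x)`. -/
def eof (x : ℝ) : ℝ := Real.binEntropy ((1 + √(1 - x)) / 2) / Real.log 2

lemma eof_nonneg {x : ℝ} (hx : 0 ≤ x) : 0 ≤ eof x := by
  have h1 : √(1 - x) ≤ 1 := Real.sqrt_le_iff.2 ⟨zero_le_one, by linarith⟩
  exact div_nonneg (Real.binEntropy_nonneg (by positivity) (by linarith))
    (Real.log_nonneg (by norm_num))

lemma h_eq_binEntropy (x : ℝ) : h x = Real.binEntropy x / Real.log 2 := by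
  simp only [h, Real.logb, Real.binEntropy, Real.log_inv]
  ring

lemma eof_four_ninths : eof (4 / 9) = h (1 / 2 + √5 / 6) := by
  have h1 : √(1 - 4 / 9 : ℝ) = √5 / 3 := by
    rw [show (1 - 4 / 9 : ℝ) = 5 / 3 ^ 2 by norm_num, Real.sqrt_div (by norm_num),
      Real.sqrt_sq (by norm_num)]
  rw [h_eq_binEntropy, eof, h1]
  ring_nf

/-- The log-ratio `log ((1 + s) / (1 - s))` divided by `s` is monotone on `(0, 1)`. -/
lemma mul_logRatio_le {s t : ℝ} (hs : 0 ≤ s) (hst : s ≤ t) (ht : t < 1) :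
    t * (Real.log (1 + s) - Real.log (1 - s)) ≤ s * (Real.log (1 + t) - Real.log (1 - t)) := by
  have hd : ∀ x ∈ Set.Ico (0 : ℝ) 1,
      HasDerivAt (fun x : ℝ => Real.log (1 + x) - Real.log (1 - x)) (2 / (1 - x ^ 2)) x := by
    intro x hx
    have h1 : (1 + x) ≠ 0 := by linarith [hx.1]
    have h2 : (1 - x) ≠ 0 := by linarith [hx.2]
    have h3 : (1 - x ^ 2) ≠ 0 := by
      rw [show 1 - x ^ 2 = (1 + x) * (1 - x) by ring]
      exact mul_ne_zero h1 h2
    refine ((((hasDerivAt_id x).const_add 1).log h1).sub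
      (((hasDerivAt_id x).const_sub 1).log h2)).congr_deriv ?_
    simp only [id]
    field_simp
    ring
  -- A convex function vanishing at 0 has increasing chord slopes from the origin.
  have hconv : ConvexOn ℝ (Set.Ico (0 : ℝ) 1)
      (fun x : ℝ => Real.log (1 + x) - Real.log (1 - x)) := by
    refine MonotoneOn.convexOn_of_deriv (convex_Ico 0 1)
      (fun x hx => (hd x hx).continuousAt.continuousWithinAt)
      (fun x hx => (hd x (interior_subset hx)).differentiableAt.differentiableWithinAt) ?_
    intro x hx y hy hxy
    rw [(hd x (interior_subset hx)).deriv, (hd y (interior_subset hy)).deriv]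
    rw [interior_Ico] at hx hy
    have : 0 < 1 - y ^ 2 := by nlinarith [hy.1, hy.2]
    have : x ^ 2 ≤ y ^ 2 := by nlinarith [hx.1]
    gcongr
  rcases hs.eq_or_lt with rfl | hs
  · simp
  have ht0 : 0 < t := hs.trans_le hst
  have := hconv.2 (show t ∈ Set.Ico (0 : ℝ) 1 from ⟨ht0.le, ht⟩)
    (show (0 : ℝ) ∈ Set.Ico (0 : ℝ) 1 from ⟨le_rfl, one_pos⟩)
    (show 0 ≤ s / t by positivity) (show 0 ≤ 1 - s / t by
    rw [sub_nonneg, div_le_one ht0]; exact hst) (by ring)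
  simp only [smul_eq_mul, mul_zero, add_zero, Real.log_one, sub_zero, sub_self,
    div_mul_cancel₀ s ht0.ne'] at this
  rw [div_mul_eq_mul_div, le_div_iff₀ ht0] at this
  linarith

/-- The binary entropy of bias `s` lies below its tangent at `s₀`, as a function of `s²`. -/
lemma binEntropy_bias_le {s₀ s : ℝ} (h₀ : 0 < s₀) (h₁ : s₀ < 1) (hs : s ∈ Set.Icc (0 : ℝ) 1) :
    Real.binEntropy ((1 + s) / 2) ≤ Real.binEntropy ((1 + s₀) / 2)
      + (Real.log (1 + s₀) - Real.log (1 - s₀)) / (4 * s₀) * (s₀ ^ 2 - s ^ 2) := by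
  set κ := (Real.log (1 + s₀) - Real.log (1 - s₀)) / (4 * s₀) with hκ
  have hκ' : Real.log (1 + s₀) - Real.log (1 - s₀) = 4 * s₀ * κ := by
    rw [hκ]; field_simp
  -- The claim is that `D` is maximal at `s₀`. Its derivative changes sign there because the
  -- log-ratio divided by `s` is monotone, and `κ` is a quarter of that quotient at `s₀`.
  let D : ℝ → ℝ := fun s => Real.binEntropy ((1 + s) / 2) + κ * s ^ 2
  have hcont : Continuous D := by
    have := Real.binEntropy_continuous
    fun_prop
  have hd : ∀ x ∈ Set.Ioo (0 : ℝ) 1,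
      HasDerivAt D (2 * κ * x - (Real.log (1 + x) - Real.log (1 - x)) / 2) x := by
    intro x hx
    have h1 : (1 + x) / 2 ≠ 0 := by linarith [hx.1]
    have h2 : (1 + x) / 2 ≠ 1 := by linarith [hx.2]
    have h3 := (Real.hasDerivAt_binEntropy h1 h2).comp x
      (((hasDerivAt_id x).const_add 1).div_const 2)
    refine (h3.add (((hasDerivAt_id x).pow 2).const_mul κ)).congr_deriv ?_
    rw [show 1 - (1 + x) / 2 = (1 - x) / 2 by ring,
      Real.log_div (by linarith [hx.2]) two_ne_zero, Real.log_div (by linarith [hx.1]) two_ne_zero]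
    simp only [id]
    ring
  suffices D s ≤ D s₀ by
    simp only [D] at this
    linarith
  rcases le_total s s₀ with hle | hle
  · have hmono : MonotoneOn D (Set.Icc 0 s₀) := by
      have hsub : ∀ x ∈ interior (Set.Icc 0 s₀), x ∈ Set.Ioo (0 : ℝ) 1 := by
        intro x hx
        rw [interior_Icc] at hx
        exact ⟨hx.1, hx.2.trans h₁⟩
      refine monotoneOn_of_deriv_nonneg (convex_Icc 0 s₀) hcont.continuousOn
        (fun x hx => (hd x (hsub x hx)).differentiableAt.differentiableWithinAt) fun x hx => ?_
      rw [(hd x (hsub x hx)).deriv]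
      rw [interior_Icc] at hx
      have := mul_logRatio_le hx.1.le hx.2.le h₁
      rw [hκ'] at this
      have : s₀ * (Real.log (1 + x) - Real.log (1 - x)) ≤ s₀ * (4 * κ * x) := by linarith
      linarith [le_of_mul_le_mul_left this h₀]
    exact hmono ⟨hs.1, hle⟩ ⟨h₀.le, le_rfl⟩ hle
  · have hanti : AntitoneOn D (Set.Icc s₀ 1) := by
      have hsub : ∀ x ∈ interior (Set.Icc s₀ 1), x ∈ Set.Ioo (0 : ℝ) 1 := by
        intro x hx
        rw [interior_Icc] at hx
        exact ⟨h₀.trans hx.1, hx.2⟩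
      refine antitoneOn_of_deriv_nonpos (convex_Icc s₀ 1) hcont.continuousOn
        (fun x hx => (hd x (hsub x hx)).differentiableAt.differentiableWithinAt) fun x hx => ?_
      rw [(hd x (hsub x hx)).deriv]
      rw [interior_Icc] at hx
      have := mul_logRatio_le h₀.le hx.1.le hx.2
      rw [hκ'] at this
      have : s₀ * (4 * κ * x) ≤ s₀ * (Real.log (1 + x) - Real.log (1 - x)) := by linarith
      linarith [le_of_mul_le_mul_left this h₀]
    exact hanti ⟨le_rfl, h₁.le⟩ ⟨hle, hs.2⟩ hle

/-- All three values are compared with the same tangent at 4/9; its slope is nonnegative, so an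
upper bound on the sum of the arguments is enough. -/
lemma eof_add_le {x y z : ℝ} (hx : x ∈ Set.Icc (0 : ℝ) 1) (hy : y ∈ Set.Icc (0 : ℝ) 1)
    (hz : z ∈ Set.Icc (0 : ℝ) 1) (hsum : x + y + z ≤ 4 / 3) :
    eof x + eof y + eof z ≤ 3 * eof (4 / 9) := by
  have hs0 : 0 < √(1 - 4 / 9 : ℝ) := Real.sqrt_pos.2 (by norm_num)
  have hs1 : √(1 - 4 / 9 : ℝ) < 1 := by
    rw [Real.sqrt_lt' one_pos]; norm_num
  have hsq : √(1 - 4 / 9 : ℝ) ^ 2 = 1 - 4 / 9 := Real.sq_sqrt (by norm_num)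
  set κ := (Real.log (1 + √(1 - 4 / 9 : ℝ)) - Real.log (1 - √(1 - 4 / 9 : ℝ)))
    / (4 * √(1 - 4 / 9 : ℝ)) with hκ
  have hκ0 : 0 ≤ κ :=
    div_nonneg (sub_nonneg.2 (Real.log_le_log (by linarith) (by linarith))) (by positivity)
  have key : ∀ u ∈ Set.Icc (0 : ℝ) 1, Real.binEntropy ((1 + √(1 - u)) / 2)
      ≤ Real.binEntropy ((1 + √(1 - 4 / 9)) / 2) + κ * (u - 4 / 9) := by
    intro u hu
    have h1 : √(1 - u) ≤ 1 := Real.sqrt_le_iff.2 ⟨zero_le_one, by linarith [hu.1]⟩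
    have := binEntropy_bias_le hs0 hs1 ⟨Real.sqrt_nonneg (1 - u), h1⟩
    rw [hsq, Real.sq_sqrt (by linarith [hu.2]), ← hκ] at this
    linarith
  have hlog : 0 < Real.log 2 := Real.log_pos (by norm_num)
  simp only [eof]
  rw [← add_div, ← add_div, ← mul_div_assoc]
  gcongr
  have := mul_le_mul_of_nonneg_left hsum hκ0
  linarith [key x hx, key y hy, key z hz]

/-! ### Amplitudes of three qubits and their local invariants -/

/-- The amplitudes of three qubits. -/
abbrev Amp : Type := Fin 2 → Fin 2 → Fin 2 → ℂ

/-- The polarized form `(x, y) ↦ D(x, y)` with `D(x, x) = 2 det (∑ᵢ xᵢ Tᵢ)`. -/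
def tau (T : Amp) : Matrix (Fin 2) (Fin 2) ℂ :=
  of fun i j => T i 0 0 * T j 1 1 + T j 0 0 * T i 1 1 - T i 0 1 * T j 1 0 - T j 0 1 * T i 1 0

/-- The squared difference of the two singular values. -/
def gap (t : Matrix (Fin 2) (Fin 2) ℂ) : ℝ :=
  ‖t 0 0‖ ^ 2 + ‖t 0 1‖ ^ 2 + ‖t 1 0‖ ^ 2 + ‖t 1 1‖ ^ 2 - 2 * ‖t.det‖

/-- The squared norm. -/
def normSq (T : Amp) : ℝ := ∑ i, ∑ j, ∑ k, ‖T i j k‖ ^ 2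

/-- The action of a matrix on the first qubit. -/
def act (U : Matrix (Fin 2) (Fin 2) ℂ) (T : Amp) : Amp := fun i j k => ∑ l, U i l * T l j k

/-- Exchange of the first two qubits. -/
def exch (T : Amp) : Amp := fun j i k => T i j k

/-- Cyclic rotation of the qubits. -/
def rot (T : Amp) : Amp := fun k i j => T i j k

lemma tau_act (U : Matrix (Fin 2) (Fin 2) ℂ) (T : Amp) : tau (act U T) = U * tau T * Uᵀ := by
  ext i j
  simp only [tau, act, of_apply, mul_apply, transpose_apply, Fin.sum_univ_two]
  ring

/-- A matrix on the second qubit multiplies every slice from the left, so it scales the determinant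
and its polarization by `U.det`. -/
lemma tau_exch_act_exch (U : Matrix (Fin 2) (Fin 2) ℂ) (T : Amp) :
    tau (exch (act U (exch T))) = U.det • tau T := by
  ext i j
  simp only [tau, act, exch, of_apply, Matrix.smul_apply, smul_eq_mul, det_fin_two, Fin.sum_univ_two]
  ring

lemma tau_swap_right (T : Amp) : tau (fun i j k => T i k j) = tau T := by
  ext i j
  simp only [tau, of_apply]
  ring

lemma tau_transpose (T : Amp) : (tau T)ᵀ = tau T := by
  ext i j
  simp only [tau, of_apply, transpose_apply]
  ring

lemma norm_det_unitary {U : Matrix (Fin 2) (Fin 2) ℂ} (hU : Uᴴ * U = 1) : ‖U.det‖ = 1 := by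
  have := congrArg Matrix.det hU
  rw [det_mul, det_conjTranspose, det_one] at this
  have h2 := congrArg norm this
  rw [norm_mul, norm_star, norm_one] at h2
  nlinarith [norm_nonneg U.det]

lemma gap_smul {c : ℂ} (hc : ‖c‖ = 1) (t : Matrix (Fin 2) (Fin 2) ℂ) : gap (c • t) = gap t := by
  simp only [gap, det_smul, Matrix.smul_apply, smul_eq_mul, norm_mul, norm_pow, hc, one_pow,
    one_mul]

lemma trace_conjTranspose_mul_self_re (t : Matrix (Fin 2) (Fin 2) ℂ) :
    (tᴴ * t).trace = ((‖t 0 0‖ ^ 2 + ‖t 0 1‖ ^ 2 + ‖t 1 0‖ ^ 2 + ‖t 1 1‖ ^ 2 : ℝ) : ℂ) := by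
  simp only [trace_fin_two, mul_apply, Fin.sum_univ_two, conjTranspose_apply, RCLike.star_def,
    Complex.conj_mul']
  push_cast
  ring

/-- Both the Frobenius norm and the modulus of the determinant are unchanged by unitary factors on
either side. -/
lemma gap_conj {U : Matrix (Fin 2) (Fin 2) ℂ} (hU : Uᴴ * U = 1) (t : Matrix (Fin 2) (Fin 2) ℂ) :
    gap (U * t * Uᵀ) = gap t := by
  have h1 : ((U * t * Uᵀ)ᴴ * (U * t * Uᵀ)).trace = (tᴴ * t).trace := by
    have h2 : Uᵀ * (Uᵀ)ᴴ = 1 := by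
      rw [show (Uᵀ)ᴴ = (Uᴴ)ᵀ from rfl, ← transpose_mul, hU, transpose_one]
    calc _ = ((Uᵀ)ᴴ * (tᴴ * (Uᴴ * U) * t * Uᵀ)).trace := by
          simp only [conjTranspose_mul, Matrix.mul_assoc]
      _ = (tᴴ * t * (Uᵀ * (Uᵀ)ᴴ)).trace := by
          rw [trace_mul_comm, hU]; simp only [Matrix.mul_assoc, Matrix.one_mul]
      _ = _ := by rw [h2, Matrix.mul_one]
  rw [trace_conjTranspose_mul_self_re, trace_conjTranspose_mul_self_re] at h1
  have h3 := Complex.ofReal_injective h1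
  rw [gap, gap, h3, det_mul, det_mul, det_transpose, norm_mul, norm_mul, norm_det_unitary hU]
  ring

lemma normSq_act {U : Matrix (Fin 2) (Fin 2) ℂ} (hU : Uᴴ * U = 1) (T : Amp) :
    normSq (act U T) = normSq T := by
  have key : ∀ x y : ℂ, ‖U 0 0 * x + U 0 1 * y‖ ^ 2 + ‖U 1 0 * x + U 1 1 * y‖ ^ 2
      = ‖x‖ ^ 2 + ‖y‖ ^ 2 := by
    intro x y
    have h00 := congrFun (congrFun hU 0) 0
    have h01 := congrFun (congrFun hU 0) 1
    have h10 := congrFun (congrFun hU 1) 0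
    have h11 := congrFun (congrFun hU 1) 1
    simp [mul_apply, Fin.sum_univ_two] at h00 h01 h10 h11
    apply Complex.ofReal_injective
    push_cast
    simp only [← Complex.conj_mul', map_add, map_mul]
    linear_combination (starRingEnd ℂ x) * x * h00 + (starRingEnd ℂ x) * y * h01
      + (starRingEnd ℂ y) * x * h10 + (starRingEnd ℂ y) * y * h11
  simp only [normSq, act, Fin.sum_univ_two]
  linarith [key (T 0 0 0) (T 1 0 0), key (T 0 0 1) (T 1 0 1), key (T 0 1 0) (T 1 1 0),
    key (T 0 1 1) (T 1 1 1)]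

lemma normSq_exch (T : Amp) : normSq (exch T) = normSq T := by
  simp only [normSq, exch, Fin.sum_univ_two]; ring

lemma normSq_rot (T : Amp) : normSq (rot T) = normSq T := by
  simp only [normSq, rot, Fin.sum_univ_two]; ring

/-- The sum of the squared concurrences of the three pairs. -/
def gapSum (T : Amp) : ℝ := gap (tau T) + gap (tau (exch T)) + gap (tau (rot T))

lemma gapSum_exch (T : Amp) : gapSum (exch T) = gapSum T := by
  have h1 : tau (rot (exch T)) = tau (rot T) := by
    rw [← tau_swap_right (rot T)]; rfl
  have h2 : exch (exch T) = T := rfl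
  rw [gapSum, gapSum, h1, h2]
  ring

lemma gapSum_rot (T : Amp) : gapSum (rot T) = gapSum T := by
  have h1 : tau (rot (rot T)) = tau (exch T) := by
    rw [← tau_swap_right (exch T)]; rfl
  have h2 : tau (exch (rot T)) = tau T := by
    rw [← tau_swap_right T]; rfl
  rw [gapSum, gapSum, h1, h2]
  ring

lemma gapSum_act {U : Matrix (Fin 2) (Fin 2) ℂ} (hU : Uᴴ * U = 1) (T : Amp) :
    gapSum (act U T) = gapSum T := by
  have h1 : gap (tau (act U T)) = gap (tau T) := by rw [tau_act, gap_conj hU]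
  have h2 : gap (tau (exch (act U T))) = gap (tau (exch T)) := by
    have := tau_exch_act_exch U (exch T)
    rw [show exch (exch T) = T from rfl] at this
    rw [this, gap_smul (norm_det_unitary hU)]
  have h3 : gap (tau (rot (act U T))) = gap (tau (rot T)) := by
    rw [show rot (act U T) = exch (act U (exch (rot T))) from rfl, tau_exch_act_exch,
      gap_smul (norm_det_unitary hU)]
  rw [gapSum, gapSum, h1, h2, h3]

/-- Every nonzero pair is, up to scaling, the first row of a unitary matrix. -/
lemma exists_unitary_row {x : Fin 2 → ℂ} (hx : x ≠ 0) :
    ∃ U : Matrix (Fin 2) (Fin 2) ℂ, Uᴴ * U = 1 ∧ ∃ c : ℂ, U 0 = c • x := by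
  set r := √(‖x 0‖ ^ 2 + ‖x 1‖ ^ 2) with hr
  have hpos : 0 < ‖x 0‖ ^ 2 + ‖x 1‖ ^ 2 := by
    by_contra hcon
    have h0 : ‖x 0‖ = 0 := by nlinarith [sq_nonneg ‖x 0‖, sq_nonneg ‖x 1‖]
    have h1 : ‖x 1‖ = 0 := by nlinarith [sq_nonneg ‖x 0‖, sq_nonneg ‖x 1‖]
    exact hx (funext (Fin.forall_fin_two.2 ⟨norm_eq_zero.1 h0, norm_eq_zero.1 h1⟩))
  have hr2 : r ^ 2 = ‖x 0‖ ^ 2 + ‖x 1‖ ^ 2 := Real.sq_sqrt hpos.le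
  have hr0 : (r : ℂ) ≠ 0 := by
    exact_mod_cast (Real.sqrt_pos.2 hpos).ne'
  have hr2' : (r : ℂ) ^ 2 = star (x 0) * x 0 + star (x 1) * x 1 := by
    simp only [RCLike.star_def, Complex.conj_mul']
    exact_mod_cast hr2
  refine ⟨(r : ℂ)⁻¹ • !![x 0, x 1; -star (x 1), star (x 0)], ?_, (r : ℂ)⁻¹, ?_⟩
  · rw [conjTranspose_smul, smul_mul_smul_comm]
    have h1 : (!![x 0, x 1; -star (x 1), star (x 0)] : Matrix (Fin 2) (Fin 2) ℂ)ᴴ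
        * !![x 0, x 1; -star (x 1), star (x 0)] = ((r : ℂ) ^ 2) • 1 := by
      rw [hr2']
      ext i j
      fin_cases i <;> fin_cases j <;>
        simp [mul_apply, Fin.sum_univ_two] <;> ring
    rw [h1, smul_smul]
    simp only [star_inv₀, RCLike.star_def, Complex.conj_ofReal]
    rw [show (r : ℂ)⁻¹ * (r : ℂ)⁻¹ * (r : ℂ) ^ 2 = 1 by field_simp, one_smul]
  · ext i
    fin_cases i <;> simp

/-- A complex binary quadratic form has a nontrivial zero. -/
lemma exists_isotropic (t : Matrix (Fin 2) (Fin 2) ℂ) : ∃ x : Fin 2 → ℂ, x ≠ 0 ∧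
    x 0 * x 0 * t 0 0 + x 0 * x 1 * t 0 1 + x 1 * x 0 * t 1 0 + x 1 * x 1 * t 1 1 = 0 := by
  by_cases h0 : t 1 1 = 0
  · exact ⟨![0, 1], fun hc => by simpa using congrFun hc 1, by simp [h0]⟩
  · obtain ⟨z, hz⟩ := IsAlgClosed.exists_pow_nat_eq
      ((t 0 1 + t 1 0) ^ 2 - 4 * t 1 1 * t 0 0) (n := 2) two_pos
    refine ⟨![1, (-(t 0 1 + t 1 0) + z) / (2 * t 1 1)],
      fun hc => by simpa using congrFun hc 0, ?_⟩
    simp only [cons_val_zero, cons_val_one]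
    field_simp
    linear_combination hz

/-- Local unitaries bring the first slice to a multiple of a matrix unit. -/
lemma exists_canonical (T : Amp) : ∃ T' : Amp, normSq T' = normSq T ∧ gapSum T' = gapSum T ∧
    T' 0 0 1 = 0 ∧ T' 0 1 0 = 0 ∧ T' 0 1 1 = 0 := by
  obtain ⟨x, hx, hx0⟩ := exists_isotropic (tau T)
  obtain ⟨U, hU, c, hc⟩ := exists_unitary_row hx
  have hdet : (of (act U T 0)).det = 0 := by
    have : 2 * (of (act U T 0)).det = 0 := by
      simp only [det_fin_two, of_apply, act, Fin.sum_univ_two, hc, Pi.smul_apply, smul_eq_mul]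
      simp only [tau, of_apply] at hx0
      linear_combination c ^ 2 * hx0
    simpa using this
  -- Unitaries whose first rows are the left and right null vectors of the singular slice annihilate
  -- its first row and column; the flip moves these zeros to index 1.
  obtain ⟨y, hy, hy0⟩ := exists_vecMul_eq_zero_iff.2 hdet
  obtain ⟨V, hV, d, hd⟩ := exists_unitary_row hy
  obtain ⟨z, hz, hz0⟩ := exists_mulVec_eq_zero_iff.2 hdet
  obtain ⟨W, hW, e, he⟩ := exists_unitary_row hz
  have hflip : (!![0, 1; 1, 0] : Matrix (Fin 2) (Fin 2) ℂ)ᴴ * !![0, 1; 1, 0] = 1 := by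
    ext i j
    fin_cases i <;> fin_cases j <;> simp [mul_apply, Fin.sum_univ_two]
  have hV' : (!![0, 1; 1, 0] * V)ᴴ * (!![0, 1; 1, 0] * V) = 1 := by
    rw [conjTranspose_mul, Matrix.mul_assoc, ← Matrix.mul_assoc _ _ V, hflip, Matrix.one_mul, hV]
  have hW' : (!![0, 1; 1, 0] * W)ᴴ * (!![0, 1; 1, 0] * W) = 1 := by
    rw [conjTranspose_mul, Matrix.mul_assoc, ← Matrix.mul_assoc _ _ W, hflip, Matrix.one_mul, hW]
  have hyk : ∀ k, y 0 * act U T 0 0 k + y 1 * act U T 0 1 k = 0 := fun k => by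
    simpa [vecMul, dotProduct, Fin.sum_univ_two] using congrFun hy0 k
  have hzk : ∀ j, act U T 0 j 0 * z 0 + act U T 0 j 1 * z 1 = 0 := fun j => by
    simpa [mulVec, dotProduct, Fin.sum_univ_two] using congrFun hz0 j
  refine ⟨rot (rot (act (!![0, 1; 1, 0] * W) (rot (exch (act (!![0, 1; 1, 0] * V)
    (exch (act U T))))))), ?_, ?_, ?_, ?_, ?_⟩
  · simp only [normSq_rot, normSq_exch, normSq_act hU, normSq_act hV', normSq_act hW']
  · simp only [gapSum_rot, gapSum_exch, gapSum_act hU, gapSum_act hV', gapSum_act hW']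
  all_goals
    generalize act U T = S at *
    simp [rot, exch, act, mul_apply, Fin.sum_univ_two, hd, he]
    have h0 := hyk 0
    have h1 := hyk 1
    have g0 := hzk 0
    have g1 := hzk 1
  · linear_combination e * V 1 0 * g0 + e * V 1 1 * g1
  · linear_combination d * W 1 0 * h0 + d * W 1 1 * h1
  · linear_combination d * e * z 0 * h0 + d * e * z 1 * h1

/-- The squared concurrences of the three pairs of a three-qubit pure state add up to at most
`4 / 3`. -/
lemma gapSum_le (T : Amp) (hT : normSq T = 1) : gapSum T ≤ 4 / 3 := by
  obtain ⟨S, hS, hg, h1, h2, h3⟩ := exists_canonical T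
  rw [← hg]
  rw [hT] at hS
  simp only [normSq, Fin.sum_univ_two, h1, h2, h3, norm_zero] at hS
  have hdet : ‖S 1 0 0 * S 1 1 1 - S 1 0 1 * S 1 1 0‖
      ≤ ‖S 1 0 0‖ * ‖S 1 1 1‖ + ‖S 1 0 1‖ * ‖S 1 1 0‖ := by
    rw [← norm_mul, ← norm_mul]
    exact norm_sub_le _ _
  -- In canonical form each `tau` has a zero diagonal entry, so `2 * ‖det‖` cancels the off-diagonal
  -- terms and only the other diagonal entry survives.
  have hgap : gapSum S = 4 * ‖S 1 0 0 * S 1 1 1 - S 1 0 1 * S 1 1 0‖ ^ 2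
      + 4 * ‖S 0 0 0‖ ^ 2 * (‖S 1 0 1‖ ^ 2 + ‖S 1 1 0‖ ^ 2) := by
    have e1 : gap (tau S) = 4 * ‖S 1 0 0 * S 1 1 1 - S 1 0 1 * S 1 1 0‖ ^ 2 := by
      have : tau S 1 1 = 2 * (S 1 0 0 * S 1 1 1 - S 1 0 1 * S 1 1 0) := by
        simp only [tau, of_apply]; ring
      rw [gap, det_fin_two, this]
      simp [tau, h1, h2, h3]
      ring
    have e2 : gap (tau (exch S)) = 4 * ‖S 0 0 0‖ ^ 2 * ‖S 1 0 1‖ ^ 2 := by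
      have : tau (exch S) 0 0 = 2 * (S 0 0 0 * S 1 0 1) := by
        simp only [tau, exch, of_apply, h1]; ring
      rw [gap, det_fin_two, this]
      simp [tau, exch, h1, h2, h3]
      ring
    have e3 : gap (tau (rot S)) = 4 * ‖S 0 0 0‖ ^ 2 * ‖S 1 1 0‖ ^ 2 := by
      have : tau (rot S) 0 0 = 2 * (S 0 0 0 * S 1 1 0) := by
        simp only [tau, rot, of_apply, h2]; ring
      rw [gap, det_fin_two, this]
      simp [tau, rot, h1, h2, h3]
      ring
    rw [gapSum, e1, e2, e3]
    ring
  rw [hgap]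
  have hd2 : ‖S 1 0 0 * S 1 1 1 - S 1 0 1 * S 1 1 0‖ ≤ (1 - ‖S 0 0 0‖ ^ 2) / 2 := by
    nlinarith [sq_nonneg (‖S 1 0 0‖ - ‖S 1 1 1‖), sq_nonneg (‖S 1 0 1‖ - ‖S 1 1 0‖)]
  have hd3 := pow_le_pow_left₀ (norm_nonneg _) hd2 2
  have hs : ‖S 1 0 1‖ ^ 2 + ‖S 1 1 0‖ ^ 2 ≤ 1 - ‖S 0 0 0‖ ^ 2 := by
    nlinarith [sq_nonneg ‖S 1 0 0‖, sq_nonneg ‖S 1 1 1‖]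
  have hp := mul_le_mul_of_nonneg_left hs (sq_nonneg ‖S 0 0 0‖)
  -- With `p = ‖S 0 0 0‖ ^ 2` the bound is (1 - p)² + 4p(1 - p) = 4/3 - (3p - 1)²/3.
  nlinarith [sq_nonneg (3 * ‖S 0 0 0‖ ^ 2 - 1)]

/-! ### Diagonalization of complex symmetric forms and the optimal measurement -/

lemma exists_phase (z : ℂ) : ∃ e : ℂ, ‖e‖ = 1 ∧ e * z = ‖z‖ := by
  refine ⟨Complex.exp ((-z.arg : ℝ) * Complex.I), Complex.norm_exp_ofReal_mul_I _, ?_⟩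
  conv_lhs => rw [← Complex.norm_mul_exp_arg_mul_I z]
  rw [mul_left_comm, ← Complex.exp_add]
  simp

lemma exists_phase_sq (z : ℂ) {c : ℂ} (hc : ‖c‖ = 1) : ∃ e : ℂ, ‖e‖ = 1 ∧ e ^ 2 * z = c * ‖z‖ := by
  obtain ⟨e, he, hez⟩ := exists_phase z
  obtain ⟨f, hf⟩ := IsAlgClosed.exists_pow_nat_eq (c * e) (n := 2) two_pos
  refine ⟨f, ?_, by rw [hf, mul_assoc, hez]⟩
  have := congrArg norm hf
  rw [norm_pow, norm_mul, he, hc, one_mul] at this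
  exact (pow_eq_one_iff_of_nonneg (norm_nonneg f) two_ne_zero).1 this

/-- The real part of a complex binary quadratic form has a maximizer on the unit sphere. -/
lemma exists_max_re (t : Matrix (Fin 2) (Fin 2) ℂ) : ∃ u v : ℂ, ‖u‖ ^ 2 + ‖v‖ ^ 2 = 1 ∧
    ∀ x y : ℂ, (x ^ 2 * t 0 0 + 2 * x * y * t 0 1 + y ^ 2 * t 1 1).re
      ≤ (u ^ 2 * t 0 0 + 2 * u * v * t 0 1 + v ^ 2 * t 1 1).re * (‖x‖ ^ 2 + ‖y‖ ^ 2) := by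
  let K : Set (ℂ × ℂ) := {w | ‖w.1‖ ^ 2 + ‖w.2‖ ^ 2 = 1}
  have hK : IsCompact K := by
    refine Metric.isCompact_of_isClosed_isBounded
      (isClosed_eq (by fun_prop) continuous_const) ?_
    refine (Metric.isBounded_closedBall (x := (0 : ℂ × ℂ)) (r := 1)).subset fun w hw => ?_
    have hw' : ‖w.1‖ ^ 2 + ‖w.2‖ ^ 2 = 1 := hw
    rw [mem_closedBall_zero_iff, Prod.norm_def]
    exact max_le (by nlinarith [norm_nonneg w.1, sq_nonneg ‖w.2‖])
      (by nlinarith [norm_nonneg w.2, sq_nonneg ‖w.1‖])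
  obtain ⟨w, hw, hmax⟩ := hK.exists_isMaxOn ⟨(1, 0), by simp [K]⟩
    (f := fun w : ℂ × ℂ => (w.1 ^ 2 * t 0 0 + 2 * w.1 * w.2 * t 0 1 + w.2 ^ 2 * t 1 1).re)
    (by fun_prop)
  refine ⟨w.1, w.2, hw, fun x y => ?_⟩
  rcases (add_nonneg (sq_nonneg ‖x‖) (sq_nonneg ‖y‖)).eq_or_lt with h0 | hpos
  · have hx : x = 0 := by
      rw [← norm_eq_zero]; nlinarith [sq_nonneg ‖x‖, sq_nonneg ‖y‖]
    have hy : y = 0 := by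
      rw [← norm_eq_zero]; nlinarith [sq_nonneg ‖x‖, sq_nonneg ‖y‖]
    simp [hx, hy]
  · set r := √(‖x‖ ^ 2 + ‖y‖ ^ 2) with hr
    have hr2 : r ^ 2 = ‖x‖ ^ 2 + ‖y‖ ^ 2 := Real.sq_sqrt hpos.le
    have hr0 : 0 < r := Real.sqrt_pos.2 hpos
    have hmem : (((r⁻¹ : ℝ) : ℂ) * x, ((r⁻¹ : ℝ) : ℂ) * y) ∈ K := by
      simp only [K, Set.mem_ofPred_eq, norm_mul, Complex.norm_real, norm_inv,
        Real.norm_of_nonneg hr0.le, mul_pow, ← mul_add, ← hr2]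
      field_simp
    have h1 := hmax hmem
    have h2 : (((r⁻¹ : ℝ) : ℂ) * x) ^ 2 * t 0 0
        + 2 * (((r⁻¹ : ℝ) : ℂ) * x) * (((r⁻¹ : ℝ) : ℂ) * y) * t 0 1
        + (((r⁻¹ : ℝ) : ℂ) * y) ^ 2 * t 1 1 = (((r ^ 2)⁻¹ : ℝ) : ℂ)
          * (x ^ 2 * t 0 0 + 2 * x * y * t 0 1 + y ^ 2 * t 1 1) := by
      push_cast
      ring
    simp only [Set.mem_ofPred_eq, h2, Complex.re_ofReal_mul] at h1
    rw [← hr2]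
    rwa [inv_mul_le_iff₀ (by positivity), mul_comm (r ^ 2)] at h1

/-- Takagi's factorization of a complex symmetric matrix, with a sign in the second entry. -/
lemma exists_takagi (t : Matrix (Fin 2) (Fin 2) ℂ) (ht : tᵀ = t) :
    ∃ U : Matrix (Fin 2) (Fin 2) ℂ, Uᴴ * U = 1 ∧ ∃ a b : ℝ, a * b ≤ 0 ∧
      U * t * Uᵀ = !![(a : ℂ), 0; 0, (b : ℂ)] := by
  obtain ⟨u, v, huv, hmax⟩ := exists_max_re t
  have hsymm : t 1 0 = t 0 1 := congrFun (congrFun ht 0) 1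
  have huv' : star u * u + star v * v = 1 := by
    simp only [RCLike.star_def, Complex.conj_mul']
    exact_mod_cast huv
  set A := u ^ 2 * t 0 0 + 2 * u * v * t 0 1 + v ^ 2 * t 1 1 with hA
  set B := -u * star v * t 0 0 + (u * star u - v * star v) * t 0 1 + v * star u * t 1 1 with hB
  set D := star v ^ 2 * t 0 0 - 2 * star u * star v * t 0 1 + star u ^ 2 * t 1 1 with hD
  -- First-order condition: moving the maximizer along its orthogonal vector changes the form by `2
  -- * k * ‖B‖` to first order in `k`, which must vanish.
  have hB0 : B = 0 := by
    obtain ⟨e, he, heB⟩ := exists_phase B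
    have he' : star e * e = 1 := by
      simp only [RCLike.star_def, Complex.conj_mul', he]; simp
    have hk : ∀ k : ℝ, 2 * k * ‖B‖ ≤ k ^ 2 * (A.re - (e ^ 2 * D).re) := by
      intro k
      have h1 := hmax (u - k * e * star v) (v + k * e * star u)
      have h2 : ‖u - k * e * star v‖ ^ 2 + ‖v + k * e * star u‖ ^ 2 = 1 + k ^ 2 := by
        apply Complex.ofReal_injective
        push_cast
        rw [← Complex.conj_mul', ← Complex.conj_mul']
        simp only [map_sub, map_add, map_mul, Complex.conj_ofReal, ← RCLike.star_def, star_star]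
        linear_combination (1 + (k : ℂ) ^ 2 * (star e * e)) * huv' + (k : ℂ) ^ 2 * he'
      have h3 : (u - k * e * star v) ^ 2 * t 0 0
          + 2 * (u - k * e * star v) * (v + k * e * star u) * t 0 1
          + (v + k * e * star u) ^ 2 * t 1 1
          = A + ((2 * k * ‖B‖ : ℝ) : ℂ) + ((k ^ 2 : ℝ) : ℂ) * (e ^ 2 * D) := by
        push_cast
        rw [← heB]
        ring
      rw [h2, h3, Complex.add_re, Complex.add_re, Complex.ofReal_re, Complex.re_ofReal_mul] at h1
      linarith
    by_contra hne
    have hpos : 0 < ‖B‖ := norm_pos_iff.2 hne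
    set κ := A.re - (e ^ 2 * D).re
    have h1 := hk (‖B‖ / (|κ| + 1))
    have h2 : (‖B‖ / (|κ| + 1)) ^ 2 * κ ≤ (‖B‖ / (|κ| + 1)) ^ 2 * (|κ| + 1) :=
      mul_le_mul_of_nonneg_left (by linarith [le_abs_self κ]) (sq_nonneg _)
    have h3 : (‖B‖ / (|κ| + 1)) ^ 2 * (|κ| + 1) = ‖B‖ / (|κ| + 1) * ‖B‖ := by
      field_simp
    have h4 : 0 < ‖B‖ / (|κ| + 1) * ‖B‖ := by positivity
    linarith
  -- The phases make the diagonal entries of opposite sign, so that the trace becomes, up to sign,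
  -- the difference of the singular values.
  obtain ⟨e, he, heA⟩ := exists_phase_sq A (c := 1) norm_one
  obtain ⟨f, hf, hfD⟩ := exists_phase_sq D (c := -1) (by simp)
  have he' : star e * e = 1 := by
    simp only [RCLike.star_def, Complex.conj_mul', he]; simp
  have hf' : star f * f = 1 := by
    simp only [RCLike.star_def, Complex.conj_mul', hf]; simp
  refine ⟨!![e * u, e * v; -f * star v, f * star u], ?_, ‖A‖, -‖D‖,
    by nlinarith [norm_nonneg A, norm_nonneg D], ?_⟩
  · ext i j
    fin_cases i <;> fin_cases j <;>
      simp [mul_apply, Fin.sum_univ_two] <;> simp only [← RCLike.star_def]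
    · linear_combination star u * u * he' + star v * v * hf' + huv'
    · linear_combination star u * v * he' - star u * v * hf'
    · linear_combination star v * u * he' - star v * u * hf'
    · linear_combination star v * v * he' + star u * u * hf' + huv'
  · ext i j
    fin_cases i <;> fin_cases j <;>
      simp [mul_apply, vecMul, dotProduct, Fin.sum_univ_two, hsymm] <;>
      try simp only [← RCLike.star_def]
    · rw [← one_mul (‖A‖ : ℂ), ← heA]
      ring
    · linear_combination e * f * hB0
    · linear_combination e * f * hB0
    · rw [show -(‖D‖ : ℂ) = -1 * ‖D‖ by ring, ← hfD]
      ring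

/-- The squared norm of a slice. -/
def sliceSq (T : Amp) (x : Fin 2) : ℝ := ∑ i, ∑ k, ‖T x i k‖ ^ 2

lemma normSq_eq_add (T : Amp) : normSq T = sliceSq T 0 + sliceSq T 1 := by
  simp [normSq, sliceSq, Fin.sum_univ_two]

lemma act_act (U V : Matrix (Fin 2) (Fin 2) ℂ) (T : Amp) : act U (act V T) = act (U * V) T := by
  funext i j k
  simp only [act, mul_apply, Fin.sum_univ_two]
  ring

/-- There is an orthonormal basis of the first qubit in which both slices have the same
concurrence, whose square is the gap. -/
lemma exists_optimal_basis (T : Amp) (hT : normSq T = 1) :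
    ∃ U : Matrix (Fin 2) (Fin 2) ℂ, Uᴴ * U = 1 ∧
      ∀ x, ‖tau (act U T) x x‖ ^ 2 = gap (tau T) * sliceSq (act U T) x ^ 2 := by
  obtain ⟨V, hV, a, b, hab, hdiag⟩ := exists_takagi (tau T) (tau_transpose T)
  have hgap : gap (tau T) = (a + b) ^ 2 := by
    rw [← gap_conj hV, hdiag, gap]
    simp [det_fin_two]
    rw [← abs_mul, abs_of_nonpos hab]
    ring
  let R : ℝ → Matrix (Fin 2) (Fin 2) ℂ := fun θ =>
    !![(Real.cos θ : ℂ), (Real.sin θ : ℂ); -(Real.sin θ : ℂ), (Real.cos θ : ℂ)]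
  have hR : ∀ θ, (R θ)ᴴ * R θ = 1 := by
    intro θ
    have h1 : (Real.sin θ : ℂ) ^ 2 + (Real.cos θ : ℂ) ^ 2 = 1 := by
      exact_mod_cast Real.sin_sq_add_cos_sq θ
    ext i j
    fin_cases i <;> fin_cases j <;>
      simp [R, mul_apply, Fin.sum_univ_two, ← Complex.cos_conj, ← Complex.sin_conj] <;>
      push_cast at h1 <;> first | linear_combination h1 | ring
  set S := act V T with hS
  have hS1 : normSq S = 1 := by rw [hS, normSq_act hV, hT]
  have htau : tau S = !![(a : ℂ), 0; 0, (b : ℂ)] := by rw [hS, tau_act, hdiag]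
  -- A real rotation preserves the trace `a + b` of the form. A quarter turn exchanges the slices
  -- and negates `q`, so some angle gives each slice a share of the trace equal to its weight.
  let q : ℝ → ℝ := fun θ => a * Real.cos θ ^ 2 + b * Real.sin θ ^ 2
    - (a + b) * sliceSq (act (R θ) S) 0
  have hq : Continuous q := by
    simp only [q, sliceSq, act, R, Fin.sum_univ_two, cons_val', cons_val_zero, cons_val_one,
      of_apply, cons_val_fin_one]
    have h1 : Continuous fun θ : ℝ => (Real.cos θ : ℂ) :=
      Complex.continuous_ofReal.comp Real.continuous_cos
    have h2 : Continuous fun θ : ℝ => (Real.sin θ : ℂ) :=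
      Complex.continuous_ofReal.comp Real.continuous_sin
    fun_prop
  have hq0 : q 0 = a - (a + b) * sliceSq S 0 := by
    simp [q, sliceSq, act, R, Fin.sum_univ_two]
  have hq1 : q (Real.pi / 2) = - q 0 := by
    have h1 : q (Real.pi / 2) = b - (a + b) * sliceSq S 1 := by
      simp [q, sliceSq, act, R, Fin.sum_univ_two]
    rw [normSq_eq_add] at hS1
    rw [h1, hq0]
    linear_combination (-(a + b)) * hS1
  obtain ⟨θ, hθ⟩ : ∃ θ, q θ = 0 := by
    rcases le_total (q 0) 0 with h0 | h0
    · exact mem_range_of_exists_le_of_exists_ge hq ⟨0, h0⟩ ⟨Real.pi / 2, by rw [hq1]; linarith⟩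
    · exact mem_range_of_exists_le_of_exists_ge hq ⟨Real.pi / 2, by rw [hq1]; linarith⟩ ⟨0, h0⟩
  have hnorm : sliceSq (act (R θ) S) 0 + sliceSq (act (R θ) S) 1 = 1 := by
    rw [← normSq_eq_add, normSq_act (hR θ), hS1]
  refine ⟨R θ * V, ?_, ?_⟩
  · rw [conjTranspose_mul, Matrix.mul_assoc, ← Matrix.mul_assoc _ _ V, hR, Matrix.one_mul, hV]
  rw [← act_act, ← hS]
  have h00 : tau (act (R θ) S) 0 0 = ((a * Real.cos θ ^ 2 + b * Real.sin θ ^ 2 : ℝ) : ℂ) := by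
    rw [tau_act, htau]
    simp [R, mul_apply, Fin.sum_univ_two]
    ring
  have h11 : tau (act (R θ) S) 1 1 = ((a * Real.sin θ ^ 2 + b * Real.cos θ ^ 2 : ℝ) : ℂ) := by
    rw [tau_act, htau]
    simp [R, mul_apply, Fin.sum_univ_two]
    ring
  have e0 : a * Real.cos θ ^ 2 + b * Real.sin θ ^ 2 = (a + b) * sliceSq (act (R θ) S) 0 :=
    sub_eq_zero.1 hθ
  have e1 : a * Real.sin θ ^ 2 + b * Real.cos θ ^ 2 = (a + b) * sliceSq (act (R θ) S) 1 := by
    linear_combination (a + b) * Real.sin_sq_add_cos_sq θ - e0 - (a + b) * hnorm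
  rw [Fin.forall_fin_two, h00, h11, e0, e1, hgap, Complex.norm_real, Complex.norm_real,
    Real.norm_eq_abs, Real.norm_eq_abs, sq_abs, sq_abs, mul_pow, mul_pow]
  exact ⟨rfl, rfl⟩

/-- Arithmetic-geometric mean for the determinant of a slice. -/
lemma norm_tau_diag_le (T : Amp) (x : Fin 2) : ‖tau T x x‖ ≤ sliceSq T x := by
  have h1 : tau T x x = 2 * (T x 0 0 * T x 1 1 - T x 0 1 * T x 1 0) := by
    simp only [tau, of_apply]; ring
  have h2 : ‖T x 0 0 * T x 1 1 - T x 0 1 * T x 1 0‖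
      ≤ ‖T x 0 0‖ * ‖T x 1 1‖ + ‖T x 0 1‖ * ‖T x 1 0‖ := by
    rw [← norm_mul, ← norm_mul]
    exact norm_sub_le _ _
  rw [h1, norm_mul, Complex.norm_ofNat]
  simp only [sliceSq, Fin.sum_univ_two]
  nlinarith [sq_nonneg (‖T x 0 0‖ - ‖T x 1 1‖), sq_nonneg (‖T x 0 1‖ - ‖T x 1 0‖)]

/-- In the optimal basis the gap is the squared normalized concurrence of any slice of positive
weight. -/
lemma gap_mem_Icc (T : Amp) (hT : normSq T = 1) : gap (tau T) ∈ Set.Icc (0 : ℝ) 1 := by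
  obtain ⟨U, hU, hx⟩ := exists_optimal_basis T hT
  have hsum : sliceSq (act U T) 0 + sliceSq (act U T) 1 = 1 := by
    rw [← normSq_eq_add, normSq_act hU, hT]
  obtain ⟨x, hpos⟩ : ∃ x, 0 < sliceSq (act U T) x := by
    by_contra! hcon
    linarith [hcon 0, hcon 1]
  have h1 := hx x
  have h2 := norm_tau_diag_le (act U T) x
  have h3 : 0 < sliceSq (act U T) x ^ 2 := by positivity
  constructor
  · by_contra! hneg
    nlinarith [sq_nonneg ‖tau (act U T) x x‖, mul_pos_of_neg_of_neg hneg (neg_lt_zero.2 h3)]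
  · have h4 := pow_le_pow_left₀ (norm_nonneg _) h2 2
    rw [h1] at h4
    by_contra! hgt
    nlinarith

/-! ### Entropies of qubits and the discord of two-qubit marginals -/

/-- The reduced operator of the first two qubits. -/
def pairOp (T : Amp) : Matrix (Fin 2 × Fin 2) (Fin 2 × Fin 2) ℂ :=
  of fun p q => ∑ k, T p.1 p.2 k * star (T q.1 q.2 k)

/-- The reduced operator of the first qubit. -/
def margOp (T : Amp) : Matrix (Fin 2) (Fin 2) ℂ :=
  of fun i i' => ∑ j, ∑ k, T i j k * star (T i' j k)

lemma margOp_swap_right (T : Amp) : margOp (fun i j k => T i k j) = margOp T := by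
  ext i i'
  simp only [margOp, of_apply, Fin.sum_univ_two]
  ring

lemma traceRight_pairOp (T : Amp) : traceRight (pairOp T) = margOp T := rfl

lemma traceLeft_pairOp (T : Amp) : traceLeft (pairOp T) = margOp (exch T) := rfl

/-- Complementary marginals of a pure state have the same entropy. -/
lemma entropy_pairOp (T : Amp) : entropy (pairOp T) = entropy (margOp (rot T)) := by
  let N : Matrix (Fin 2 × Fin 2) (Fin 2) ℂ := of fun p k => T p.1 p.2 k
  have h1 : pairOp T = N * Nᴴ := by
    ext p q
    simp [pairOp, N, mul_apply]
  have h2 : margOp (rot T) = (Nᴴ * N)ᵀ := by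
    ext k k'
    simp [margOp, rot, N, mul_apply, Fintype.sum_prod_type, mul_comm]
  -- The two characteristic polynomials differ by a power of `X`, and zero eigenvalues contribute no
  -- entropy.
  have h3 := charpoly_mul_comm_of_le N Nᴴ (by simp)
  rw [entropy, entropy, h1, h2, charpoly_transpose, h3, Polynomial.roots_mul,
    Polynomial.roots_X_pow]
  · simp [Multiset.map_nsmul, Multiset.sum_nsmul]
  · exact mul_ne_zero (pow_ne_zero _ Polynomial.X_ne_zero) (charpoly_monic _).ne_zero

lemma four_mul_det_mem_Icc {ρ : Matrix (Fin 2) (Fin 2) ℂ} (hρ : ρ.PosSemidef)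
    (htr : ρ.trace = 1) : ρ.det = (ρ.det.re : ℂ) ∧ 4 * ρ.det.re ∈ Set.Icc (0 : ℝ) 1 := by
  have hdet := Complex.nonneg_iff.1 hρ.det_nonneg
  have him : ρ.det = (ρ.det.re : ℂ) := Complex.ext rfl hdet.2.symm
  refine ⟨him, by linarith [hdet.1], ?_⟩
  have h0 := Complex.nonneg_iff.1 (hρ.diag_nonneg (i := 0))
  have h1 := Complex.nonneg_iff.1 (hρ.diag_nonneg (i := 1))
  have h10 : star (ρ 0 1) = ρ 1 0 := hρ.isHermitian.apply 1 0
  have hre := congrArg Complex.re htr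
  rw [trace_fin_two, Complex.add_re, Complex.one_re] at hre
  have hd : ρ.det.re = (ρ 0 0).re * (ρ 1 1).re - ‖ρ 0 1‖ ^ 2 := by
    rw [det_fin_two, ← h10, RCLike.star_def, Complex.mul_conj', Complex.sub_re, Complex.mul_re,
      ← h0.2]
    norm_cast
    ring
  rw [hd]
  nlinarith [sq_nonneg ((ρ 0 0).re - (ρ 1 1).re), sq_nonneg ‖ρ 0 1‖]

/-- The entropy of a qubit state. -/
lemma entropy_qubit {ρ : Matrix (Fin 2) (Fin 2) ℂ} (hρ : ρ.PosSemidef) (htr : ρ.trace = 1) :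
    entropy ρ = eof (4 * ρ.det.re) := by
  obtain ⟨hdet, -, hle⟩ := four_mul_det_mem_Icc hρ htr
  set d := ρ.det.re
  set s := √(1 - 4 * d)
  have hs : s ^ 2 = 1 - 4 * d := Real.sq_sqrt (by linarith)
  have hs' : (s : ℂ) ^ 2 = 1 - 4 * (d : ℂ) := by exact_mod_cast hs
  have hfac : ρ.charpoly = (Polynomial.X - Polynomial.C (((1 + s) / 2 : ℝ) : ℂ))
      * (Polynomial.X - Polynomial.C (((1 - (1 + s) / 2 : ℝ)) : ℂ)) := by
    have hprod : (d : ℂ) = (((1 + s) / 2 : ℝ) : ℂ) * (((1 - (1 + s) / 2 : ℝ)) : ℂ) := by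
      push_cast
      linear_combination hs' / 4
    have hsum : (1 : ℂ) = (((1 + s) / 2 : ℝ) : ℂ) + (((1 - (1 + s) / 2 : ℝ)) : ℂ) := by
      push_cast
      ring
    rw [charpoly_fin_two, htr, hdet, hprod, hsum, Polynomial.C_mul, Polynomial.C_add]
    ring
  rw [entropy, hfac, Polynomial.roots_mul (mul_ne_zero (Polynomial.X_sub_C_ne_zero _)
    (Polynomial.X_sub_C_ne_zero _)), Polynomial.roots_X_sub_C, Polynomial.roots_X_sub_C, eof,
    Real.binEntropy_eq_negMulLog_add_negMulLog_one_sub]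
  simp only [Multiset.map_add, Multiset.map_singleton, Multiset.sum_add, Multiset.sum_singleton,
    Complex.ofReal_re]
  rfl

lemma trace_traceRight {a b : Type*} [Fintype a] [Fintype b] (ρ : Matrix (a × b) (a × b) ℂ) :
    (traceRight ρ).trace = ρ.trace := by
  simp [traceRight, Matrix.trace, Fintype.sum_prod_type]

/-- A sum of congruences of `Eᵀ`, which makes positivity visible. -/
lemma traceRight_effect_mul (T : Amp) (E : Matrix (Fin 2) (Fin 2) ℂ) :
    traceRight (((1 : Matrix (Fin 2) (Fin 2) ℂ) ⊗ₖ E) * pairOp T)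
      = ∑ k, (of fun i j => T i j k) * Eᵀ * (of fun i j => T i j k)ᴴ := by
  ext i i'
  simp only [traceRight, pairOp, of_apply, mul_apply, Matrix.sum_apply, kroneckerMap_apply,
    one_apply, Fintype.sum_prod_type, Fin.sum_univ_two, conjTranspose_apply, transpose_apply]
  fin_cases i <;> simp <;> ring

section Effects

variable (T : Amp) {E : Matrix (Fin 2) (Fin 2) ℂ}

lemma posSemidef_traceRight_effect_mul (hE : E.PosSemidef) :
    (traceRight (((1 : Matrix (Fin 2) (Fin 2) ℂ) ⊗ₖ E) * pairOp T)).PosSemidef := by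
  rw [traceRight_effect_mul]
  exact posSemidef_sum _ fun k _ => hE.transpose.mul_mul_conjTranspose_same _

lemma trace_traceRight_effect_mul (hE : E.PosSemidef) :
    (traceRight (((1 : Matrix (Fin 2) (Fin 2) ℂ) ⊗ₖ E) * pairOp T)).trace
      = (outcomeProb (pairOp T) E : ℂ) := by
  have h := Complex.nonneg_iff.1 (posSemidef_traceRight_effect_mul T hE).trace_nonneg
  rw [outcomeProb, ← trace_traceRight]
  exact Complex.ext rfl h.2.symm

lemma outcomeProb_nonneg (hE : E.PosSemidef) : 0 ≤ outcomeProb (pairOp T) E := by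
  have h := (posSemidef_traceRight_effect_mul T hE).trace_nonneg
  rw [trace_traceRight_effect_mul T hE] at h
  exact_mod_cast h

lemma condState_posSemidef (hE : E.PosSemidef) : (condState (pairOp T) E).PosSemidef := by
  refine (posSemidef_traceRight_effect_mul T hE).smul ?_
  rw [← Complex.ofReal_inv]
  exact_mod_cast inv_nonneg.2 (outcomeProb_nonneg T hE)

lemma condState_trace (hE : E.PosSemidef) (hp : outcomeProb (pairOp T) E ≠ 0) :
    (condState (pairOp T) E).trace = 1 := by
  rw [condState, trace_smul, trace_traceRight_effect_mul T hE, smul_eq_mul]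
  exact inv_mul_cancel₀ (by exact_mod_cast hp)

lemma outcomeProb_mul_entropy_nonneg (hE : E.PosSemidef) :
    0 ≤ outcomeProb (pairOp T) E * entropy (condState (pairOp T) E) := by
  by_cases hp : outcomeProb (pairOp T) E = 0
  · simp [hp]
  · have h1 := condState_posSemidef T hE
    have h2 := condState_trace T hE hp
    rw [entropy_qubit h1 h2]
    exact mul_nonneg (outcomeProb_nonneg T hE) (eof_nonneg (four_mul_det_mem_Icc h1 h2).2.1)

end Effects

/-- The `sSup` is a genuine supremum: conditional entropies are nonnegative, so every gain is at
most the entropy of the first marginal. -/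
lemma informationGain_le_classicalCorrelation (T : Amp) {n : ℕ}
    {P : Fin n → Matrix (Fin 2) (Fin 2) ℂ} (hP : IsPOVM P) :
    informationGain (pairOp T) P ≤ classicalCorrelation (pairOp T) := by
  refine le_csSup ⟨entropy (traceRight (pairOp T)), ?_⟩ ⟨n, P, hP, rfl⟩
  rintro v ⟨m, Q, hQ, rfl⟩
  exact sub_le_self _ (Finset.sum_nonneg fun x _ =>
    outcomeProb_mul_entropy_nonneg T (hQ.posSemidef x))

/-- The measurement in an orthonormal basis. -/
lemma isPOVM_of_unitary {U : Matrix (Fin 2) (Fin 2) ℂ} (hU : Uᴴ * U = 1) :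
    IsPOVM fun x => vecMulVec (star (U x)) (U x) where
  posSemidef x := posSemidef_vecMulVec_star_self _
  sum_eq_one := by
    rw [← hU]
    ext j j'
    simp [Matrix.sum_apply, vecMulVec_apply, mul_apply]

lemma traceRight_projection_mul (T : Amp) (U : Matrix (Fin 2) (Fin 2) ℂ) (x : Fin 2) :
    traceRight (((1 : Matrix (Fin 2) (Fin 2) ℂ) ⊗ₖ vecMulVec (star (U x)) (U x)) * pairOp T)
      = of (act U (exch T) x) * (of (act U (exch T) x))ᴴ := by
  rw [traceRight_effect_mul]
  ext i i'
  simp only [act, exch, mul_apply, Matrix.sum_apply, of_apply, conjTranspose_apply,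
    transpose_apply, vecMulVec_apply, Fin.sum_univ_two, Pi.star_apply, star_add, star_mul']
  ring

/-- The information gained by the optimal projective measurement. -/
lemma entropy_sub_eof_le_classicalCorrelation (T : Amp) (hT : normSq T = 1) :
    entropy (margOp T) - eof (gap (tau (exch T))) ≤ classicalCorrelation (pairOp T) := by
  obtain ⟨U, hU, hx⟩ := exists_optimal_basis (exch T) (by rw [normSq_exch, hT])
  refine le_trans (le_of_eq ?_)
    (informationGain_le_classicalCorrelation T (isPOVM_of_unitary hU))
  set S := act U (exch T) with hS
  have hpsd := (isPOVM_of_unitary hU).posSemidef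
  have hprob : ∀ x, outcomeProb (pairOp T) (vecMulVec (star (U x)) (U x)) = sliceSq S x := by
    intro x
    have h1 := trace_traceRight_effect_mul T (hpsd x)
    rw [traceRight_projection_mul] at h1
    apply Complex.ofReal_injective
    rw [← h1, ← hS]
    simp [sliceSq, trace_fin_two, mul_apply, Fin.sum_univ_two, Complex.mul_conj']
  -- Every outcome of nonzero weight leaves a state with four times its determinant equal to the
  -- gap, so the average entropy is one `eof` value.
  have hterm : ∀ x, outcomeProb (pairOp T) (vecMulVec (star (U x)) (U x))
      * entropy (condState (pairOp T) (vecMulVec (star (U x)) (U x)))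
      = sliceSq S x * eof (gap (tau (exch T))) := by
    intro x
    by_cases hp : sliceSq S x = 0
    · rw [hprob, hp, zero_mul, zero_mul]
    have hp' := hp
    rw [← hprob] at hp'
    rw [entropy_qubit (condState_posSemidef T (hpsd x)) (condState_trace T (hpsd x) hp'), hprob]
    congr 2
    have hdet : (of (S x) * (of (S x))ᴴ).det = ((‖tau S x x‖ ^ 2 / 4 : ℝ) : ℂ) := by
      have h1 : tau S x x = 2 * (of (S x)).det := by
        simp only [tau, of_apply, det_fin_two]; ring
      rw [det_mul, det_conjTranspose, RCLike.star_def, Complex.mul_conj', h1, norm_mul,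
        Complex.norm_ofNat]
      push_cast
      ring
    have h2 : (condState (pairOp T) (vecMulVec (star (U x)) (U x))).det
        = (((sliceSq S x)⁻¹ ^ 2 * (‖tau S x x‖ ^ 2 / 4) : ℝ) : ℂ) := by
      rw [condState, traceRight_projection_mul, hprob, det_smul, ← hS, hdet]
      push_cast
      simp
    rw [h2, Complex.ofReal_re, hx]
    field_simp
  have hnorm : sliceSq S 0 + sliceSq S 1 = 1 := by
    rw [← normSq_eq_add, hS, normSq_act hU, normSq_exch, hT]
  rw [informationGain, traceRight_pairOp, Finset.sum_congr rfl fun x _ => hterm x,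
    ← Finset.sum_mul, Fin.sum_univ_two, hnorm, one_mul]

lemma discord_pairOp_le (T : Amp) (hT : normSq T = 1) :
    discord (pairOp T) ≤ entropy (margOp (exch T)) - entropy (margOp (rot T))
      + eof (gap (tau (exch T))) := by
  have := entropy_sub_eof_le_classicalCorrelation T hT
  rw [discord, mutualInformation, traceRight_pairOp, traceLeft_pairOp, entropy_pairOp]
  linarith

end Discord

end

/-! ### Summation over the six ordered pairs -/

open Discord in
theorem mainTheorem5 (ψ : Discord.ThreeQubit) (hψ : ‖ψ‖ = 1) :
    Discord.discord (Discord.rhoAB ψ)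
      + Discord.discord (Discord.rhoBC ψ)
      + Discord.discord (Discord.swap (Discord.rhoAC ψ))
      + Discord.discord (Discord.swap (Discord.rhoAB ψ))
      + Discord.discord (Discord.rhoAC ψ)
      + Discord.discord (Discord.swap (Discord.rhoBC ψ))
      ≤ 2 * Discord.cMax := by
  let T : Amp := fun i j k => ψ (i, j, k)
  have hT : normSq T = 1 := by
    have h1 := EuclideanSpace.norm_sq_eq ψ
    rw [hψ, one_pow] at h1
    simp only [h1, normSq, T, Fintype.sum_prod_type]
  have hAB := discord_pairOp_le T hT
  have hBC := discord_pairOp_le (fun b c a => T a b c) (by rw [← hT, ← normSq_rot]; rfl)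
  have hCA := discord_pairOp_le (rot T) (by rw [normSq_rot, hT])
  have hBA := discord_pairOp_le (exch T) (by rw [normSq_exch, hT])
  have hAC := discord_pairOp_le (exch (rot T)) (by rw [normSq_exch, normSq_rot, hT])
  have hCB := discord_pairOp_le (rot (exch T)) (by rw [normSq_rot, normSq_exch, hT])
  -- The remaining index orders differ from `T`, `exch T` and `rot T` by exchanging the last two
  -- indices, which affects neither `margOp` nor `tau`.
  have mA : margOp (fun a c b => T a b c) = margOp T := margOp_swap_right T
  have mB : margOp (fun b c a => T a b c) = margOp (exch T) := margOp_swap_right (exch T)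
  have mC : margOp (fun c b a => T a b c) = margOp (rot T) := margOp_swap_right (rot T)
  have tA : tau (fun a c b => T a b c) = tau T := tau_swap_right T
  have tB : tau (fun b c a => T a b c) = tau (exch T) := tau_swap_right (exch T)
  have tC : tau (fun c b a => T a b c) = tau (rot T) := tau_swap_right (rot T)
  have hBC' : discord (rhoBC ψ) ≤ entropy (margOp (rot T)) - entropy (margOp T)
      + eof (gap (tau (rot T))) := by
    rw [← mC, ← tC]; exact hBC
  have hCA' : discord (swap (rhoAC ψ)) ≤ entropy (margOp T) - entropy (margOp (exch T))
      + eof (gap (tau T)) := by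
    rw [← mA, ← tA, ← mB]; exact hCA
  have hBA' : discord (swap (rhoAB ψ)) ≤ entropy (margOp T) - entropy (margOp (rot T))
      + eof (gap (tau T)) := by
    rw [← mC]; exact hBA
  have hAC' : discord (rhoAC ψ) ≤ entropy (margOp (rot T)) - entropy (margOp (exch T))
      + eof (gap (tau (rot T))) := by
    exact hAC
  have hCB' : discord (swap (rhoBC ψ)) ≤ entropy (margOp (exch T)) - entropy (margOp T)
      + eof (gap (tau (exch T))) := by
    rw [← mA, ← mB, ← tB]; exact hCB
  have hAB' : discord (rhoAB ψ) ≤ entropy (margOp (exch T)) - entropy (margOp (rot T))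
      + eof (gap (tau (exch T))) := hAB
  have hfin := eof_add_le (gap_mem_Icc T hT)
    (gap_mem_Icc (exch T) (by rw [normSq_exch, hT])) (gap_mem_Icc (rot T) (by rw [normSq_rot, hT]))
    (gapSum_le T hT)
  rw [eof_four_ninths] at hfin
  rw [cMax]
  linarith
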